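/- Let $F$ be a field of characteristic $p\ge 0$, let $1\le m<k$ be integers, let $A_0,\dots,A_m$ be independent variables over $F$, and let $f,g\in F[t]$ be relatively prime polynomials with $\deg g+m<k=\deg f$. Assume that 1. $m\ge 2$ if $\deg g>0$; 2. $m\ge 2$ if $p\mid k(k-1)$; 3. if $p=m=2$, then the derivative $(f/g)'\in F(t)$ of the rational function $f/g$ is not constant, i.e. does not lie in $F$. Then the polynomial $\mathcal F(t)=f(t)+g(t)\left(A_0+A_1t+\dots+A_mt^m\right)$ is separable of degree $k$ in $t$ over the rational function field $F(A_0,\dots,A_m)$, and its Galois group over $F(A_0,\dots,A_m)$, acting on its $k$ distinct roots, is the full symmetric group $S_k$. -/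

import Mathlib

open Polynomial

/-- The formal derivative on the rational function field `F(t)`, given by the quotient rule
applied to the reduced fraction. -/
noncomputable def ratDeriv {F : Type*} [Field F] (φ : RatFunc F) : RatFunc F :=
  algebraMap F[X] (RatFunc F)
      (derivative φ.num * φ.denom - φ.num * derivative φ.denom) /
    algebraMap F[X] (RatFunc F) φ.denom ^ 2

/-- The quotient rule holds for every representation of a rational function as a fraction. -/
theorem ratDeriv_div {F : Type*} [Field F] (f g : F[X]) (hg : g ≠ 0) :
    ratDeriv (algebraMap F[X] (RatFunc F) f / algebraMap F[X] (RatFunc F) g) =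
      algebraMap F[X] (RatFunc F) (derivative f * g - f * derivative g) /
        algebraMap F[X] (RatFunc F) g ^ 2 := by
  unfold ratDeriv
  set φ := algebraMap F[X] (RatFunc F) f / algebraMap F[X] (RatFunc F) g with hφ
  have hd : φ.denom ≠ 0 := RatFunc.denom_ne_zero φ
  have hg' : algebraMap F[X] (RatFunc F) g ≠ 0 := RatFunc.algebraMap_ne_zero hg
  have hd' : algebraMap F[X] (RatFunc F) φ.denom ≠ 0 := RatFunc.algebraMap_ne_zero hd
  have h : φ.num * g = f * φ.denom := RatFunc.num_div_denom φ |>.trans hφ |> fun e => by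
    rw [div_eq_div_iff hd' hg', ← map_mul, ← map_mul] at e
    exact RatFunc.algebraMap_injective F e
  have h' := congrArg derivative h
  simp only [derivative_mul] at h'
  rw [div_eq_div_iff (pow_ne_zero 2 hd') (pow_ne_zero 2 hg'), ← map_pow, ← map_pow,
    ← map_mul, ← map_mul]
  congr 1
  linear_combination (g * φ.denom) * h' - (derivative g * φ.denom + g * derivative φ.denom) * h

/-- The action of the Galois group of `P` over `K` on the set of roots of `P` in a splitting
field of `P`. -/
noncomputable def galRootPerm {K : Type*} [Field K] (P : K[X]) :
    P.Gal →* Equiv.Perm (P.rootSet P.SplittingField) :=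
  haveI : Fact ((P.map (algebraMap K P.SplittingField)).Splits) := ⟨SplittingField.splits P⟩
  Gal.galActionHom P P.SplittingField

/-- `Gal(P, K) = S_k`: the polynomial `P` is separable of degree `k` (so that it has `k` distinct
roots), and its Galois group over `K`, acting on these roots, is the full symmetric group. -/
def GaloisGroupIsSymmetric {K : Type*} [Field K] (P : K[X]) (k : ℕ) : Prop :=
  P.natDegree = k ∧ P.Separable ∧ Function.Bijective (galRootPerm P)

/-- The rational function field `F(A_0, …, A_m)`. -/
abbrev ParamField (F : Type*) [Field F] (m : ℕ) : Type _ :=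
  FractionRing (MvPolynomial (Fin (m + 1)) F)

/-- The polynomial `f(t) + g(t) (A_0 + A_1 t + ⋯ + A_m t ^ m)` in `t` over `F(A_0, …, A_m)`. -/
noncomputable def genericPoly {F : Type*} [Field F] (m : ℕ) (f g : F[X]) : (ParamField F m)[X] :=
  f.map (algebraMap F (ParamField F m)) + g.map (algebraMap F (ParamField F m)) *
    ∑ i : Fin (m + 1),
      C (algebraMap (MvPolynomial (Fin (m + 1)) F) (ParamField F m) (MvPolynomial.X i)) *
        X ^ (i : ℕ)

/-!
Write `P = f + g * (A₀ + A₁ X + ⋯ + A_m X ^ m)` and let `G` be its Galois group over the parameter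
field `K = F(A₀, …, A_m)`. The theorem follows from two facts.

*The group `G` is doubly transitive, and `P` is separable.* If `x ≠ y` are roots of `P`, then `A₀`
and `A₁` are obtained from `x`, `y`, `A₂`, …, `A_m` by interpolation of `-f / g`, so by counting
transcendence degrees `x, y, A₂, …, A_m` are algebraically independent over `F`
(`algebraicIndependent_replaceTwo`). Given another such pair `x', y'`, the map `x ↦ x'`, `y ↦ y'`,
`A_i ↦ A_i` for `i ≥ 2` therefore extends to a field embedding of the splitting field; it fixes `A₀`
and `A₁` because they are given by the same formulas in terms of either pair
(`exists_algEquiv_apply_eq`). In the same way, a multiple root would express `A₀` and `A₁` by itself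
and the remaining parameters (`eval_derivative_familyPoly_ne_zero`).

*The group `G` contains a transposition.* It is enough to embed `K` into a field `E` in which `P`
has exactly `k - 2` roots (`exists_isSwap_galRootPerm`). Here `E` is the field of Laurent series in
`s` over an algebraically closed field `L`. The parameters are chosen in `L` such that `P` acquires
a double root `x`, all other roots being simple, and then `A₀` is replaced by `A₀ + s`. By Hensel's
lemma the simple roots lift to `E`, while the double root does not, as `g x ≠ 0`
(`ncard_roots_deformation`). This avoids any discussion of ramification, which would be wild in
characteristic two. The parameters stay algebraically independent provided that `A₁, …, A_m` are,
and this is arranged by taking `x` and `A₂, …, A_m` generic and solving for `A₀` and `A₁`.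

It remains to see that no other multiple root occurs. For `m ≥ 2` one has
`P = (X - x) ^ 2 * (h + A₂ g)`, where `h` does not involve `A₂`. A multiple root of `h + A₂ g` would be
a zero of the Wronskian of `h` and `g`, which does not vanish identically, and so would be algebraic
over `F(x, A₃, …, A_m)`, and `A₂` with it (`exists_eq_sq_mul_add_tangent`,
`separable_map_add_C_mul`). The parameters `A_i` with
`i ≥ 3` are put into the base field (`exists_hasUniqueDoubleRoot_of_two_le`). For `m = 1` the
polynomial `g` is constant, `f''` is nonzero because the characteristic does not divide `k (k - 1)`,
and the claim is that the tangent to the graph of `f` at a generic point `x` touches the graph at no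
other point `y`; this follows by applying to the equation of the tangent the extension of `d / dx`
to the separable closure of `F(x)` (`eq_of_common_tangent`).
-/

/-! ### Algebraic independence -/

/-- If every member of an algebraically independent family is algebraic over the field generated by
a family with the same finite index type, then the latter is algebraically independent too. -/
theorem algebraicIndependent_of_isAlgebraic_adjoin {F Ω ι : Type*} [Field F] [Field Ω]
    [Algebra F Ω] [Finite ι] {a b : ι → Ω} (hb : AlgebraicIndependent F b)
    (h : ∀ i, IsAlgebraic (IntermediateField.adjoin F (Set.range a)) (b i)) :
    AlgebraicIndependent F a := by
  have hsub : Set.range b ⊆ (AlgebraicIndependent.matroid F Ω).closure (Set.range a) := by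
    rintro _ ⟨i, rfl⟩
    rw [AlgebraicIndependent.matroid_closure_eq, SetLike.mem_coe, Subalgebra.mem_algebraicClosure]
    exact IntermediateField.isAlgebraic_adjoin_iff.1 (h i)
  have hle : (Set.range b).encard ≤ (AlgebraicIndependent.matroid F Ω).eRk (Set.range a) := by
    rw [← Matroid.eRk_closure_eq]
    exact (AlgebraicIndependent.matroid_indep_iff.2
      hb.to_subtype_range).encard_le_eRk_of_subset hsub
  have hcard : (Set.range a).encard ≤ (Set.range b).encard := by
    rw [← Set.image_univ, ← Set.image_univ, hb.injective.encard_image]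
    exact Set.encard_image_le _ _
  have hindep : (AlgebraicIndependent.matroid F Ω).Indep (Set.range a) :=
    (Matroid.indep_iff_eRk_eq_encard_of_finite (Set.finite_range a)).2
      ((Matroid.eRk_le_encard _ _).antisymm (hcard.trans hle))
  have hinj : Function.Injective a := by
    rw [← Set.injOn_univ]
    refine Set.finite_univ.injOn_of_encard_image_eq ((Set.encard_image_le _ _).antisymm ?_)
    rw [Set.image_univ, ← hb.injective.encard_image, Set.image_univ]
    exact hle.trans (Matroid.eRk_le_encard _ _)
  exact (algebraicIndependent_subtype_range hinj).1
    (AlgebraicIndependent.matroid_indep_iff.1 hindep)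

/-! ### The linear family of polynomials -/

/-- The polynomial `f + g * ∑ i, a i * X ^ i` over an extension of the base field: the member of
the linear family spanned by `g, X * g, X ^ 2 * g, …` and based at `f` with coordinates `a`. -/
noncomputable def familyPoly {F E : Type*} [Field F] [Field E] [Algebra F E] {n : ℕ}
    (f g : F[X]) (a : Fin n → E) : E[X] :=
  f.map (algebraMap F E) + g.map (algebraMap F E) * ∑ i, C (a i) * X ^ (i : ℕ)

theorem genericPoly_eq_familyPoly {F : Type*} [Field F] (m : ℕ) (f g : F[X]) :
    genericPoly m f g = familyPoly f g fun i : Fin (m + 1) =>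
      algebraMap (MvPolynomial (Fin (m + 1)) F) (ParamField F m) (MvPolynomial.X i) :=
  rfl

section
variable {F E : Type*} [Field F] [Field E] [Algebra F E] {n : ℕ} {f g : F[X]}

theorem eval_familyPoly (a : Fin n → E) (x : E) :
    (familyPoly f g a).eval x = aeval x f + aeval x g * ∑ i, a i * x ^ (i : ℕ) := by
  simp [familyPoly, eval_finsetSum]

theorem eval_derivative_familyPoly (a : Fin n → E) (x : E) :
    (derivative (familyPoly f g a)).eval x = aeval x (derivative f) +
      aeval x (derivative g) * (∑ i, a i * x ^ (i : ℕ)) +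
      aeval x g * (derivative (∑ i, C (a i) * X ^ (i : ℕ) : E[X])).eval x := by
  simp only [familyPoly, derivative_add, derivative_mul, eval_add, eval_mul, derivative_map,
    eval_map_algebraMap, eval_finsetSum, eval_C, eval_pow, eval_X]
  ring

theorem map_familyPoly {E' : Type*} [Field E'] [Algebra F E'] (φ : E →ₐ[F] E') (a : Fin n → E) :
    (familyPoly f g a).map φ.toRingHom = familyPoly f g (φ ∘ a) := by
  simp [familyPoly, Polynomial.map_sum, Polynomial.map_map]

theorem natDegree_map_mul_sum_lt {a : Fin n → E} (h : g.natDegree + n < f.natDegree + 1)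
    (hn : 0 < n) :
    (g.map (algebraMap F E) * ∑ i, C (a i) * X ^ (i : ℕ)).natDegree <
      (f.map (algebraMap F E)).natDegree := by
  rw [natDegree_map]
  refine lt_of_le_of_lt (natDegree_mul_le_of_le natDegree_map_le
    (natDegree_sum_le_of_forall_le (n := n - 1) _ _ fun i _ =>
      (natDegree_C_mul_X_pow_le _ _).trans (by omega))) (by omega)

theorem natDegree_familyPoly {a : Fin n → E} (h : g.natDegree + n < f.natDegree + 1)
    (hn : 0 < n) :
    (familyPoly f g a).natDegree = f.natDegree := by
  rw [familyPoly, natDegree_add_eq_left_of_natDegree_lt (natDegree_map_mul_sum_lt h hn),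
    natDegree_map]

theorem aeval_ne_zero_of_eval_familyPoly_eq_zero (hfg : IsCoprime f g) {a : Fin n → E} {x : E}
    (hx : (familyPoly f g a).eval x = 0) : aeval x g ≠ 0 := by
  intro hg
  rw [eval_familyPoly, hg, zero_mul, add_zero] at hx
  obtain ⟨u, v, huv⟩ := hfg
  simpa [hx, hg] using congrArg (aeval x) huv

theorem IntermediateField.aeval_mem_of_mem (K : IntermediateField F E) {x : E} (hx : x ∈ K)
    (p : F[X]) : aeval x p ∈ K := by
  have : aeval x p = ((aeval (⟨x, hx⟩ : K) p : K) : E) :=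
    (aeval_algebraMap_apply E (⟨x, hx⟩ : K) p)
  rw [this]; exact Subtype.mem _

/-! ### Interpolation and separability -/

/-- Replaces the first two entries of a family. -/
def replaceTwo (a : Fin (n + 2) → E) (x y : E) : Fin (n + 2) → E :=
  Fin.cons x (Fin.cons y fun i => a i.succ.succ)

theorem sum_two_add (a : Fin (n + 2) → E) (x : E) :
    ∑ i, a i * x ^ (i : ℕ) = a 0 + a 1 * x + ∑ i : Fin n, a i.succ.succ * x ^ ((i : ℕ) + 2) := by
  simp [Fin.sum_univ_succ]; ring

theorem derivative_sum_two_add (a : Fin (n + 2) → E) (x : E) :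
    (derivative (∑ i, C (a i) * X ^ (i : ℕ) : E[X])).eval x =
      a 1 + ∑ i : Fin n, a i.succ.succ * ((((i : ℕ) + 2 : ℕ) : E) * x ^ ((i : ℕ) + 1)) := by
  simp [Fin.sum_univ_succ, eval_finsetSum, add_assoc, one_add_one_eq_two, derivative_X_pow]

/-- Two distinct roots are, together with the parameters of index at least two, algebraically
independent: the first two parameters are obtained from them by interpolation. -/
theorem algebraicIndependent_replaceTwo (hfg : IsCoprime f g) {a : Fin (n + 2) → E}
    (ha : AlgebraicIndependent F a) {x y : E} (hxy : x ≠ y)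
    (hx : (familyPoly f g a).eval x = 0) (hy : (familyPoly f g a).eval y = 0) :
    AlgebraicIndependent F (replaceTwo a x y) := by
  refine algebraicIndependent_of_isAlgebraic_adjoin ha fun i => ?_
  set K := IntermediateField.adjoin F (Set.range (replaceTwo a x y)) with hK
  suffices h : a i ∈ K from isAlgebraic_algebraMap (⟨a i, h⟩ : K)
  have hmem : ∀ j, replaceTwo a x y j ∈ K := fun j => IntermediateField.subset_adjoin F _ ⟨j, rfl⟩
  have hxK : x ∈ K := hmem 0
  have hyK : y ∈ K := hmem 1
  have hr : ∀ j : Fin n, a j.succ.succ ∈ K := fun j => hmem j.succ.succ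
  have key : ∀ z ∈ K, (familyPoly f g a).eval z = 0 → a 0 + a 1 * z ∈ K := by
    intro z hz h0
    have hg := aeval_ne_zero_of_eval_familyPoly_eq_zero hfg h0
    rw [eval_familyPoly, sum_two_add] at h0
    have : a 0 + a 1 * z = - (aeval z f / aeval z g) -
        ∑ i : Fin n, a i.succ.succ * z ^ ((i : ℕ) + 2) := by
      field_simp
      linear_combination h0
    rw [this]
    exact sub_mem (neg_mem (div_mem (K.aeval_mem_of_mem hz f) (K.aeval_mem_of_mem hz g)))
      (sum_mem fun j _ => mul_mem (hr j) (pow_mem hz _))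
  have h1 : a 1 ∈ K := by
    have : a 1 = ((a 0 + a 1 * x) - (a 0 + a 1 * y)) / (x - y) := by
      field_simp [sub_ne_zero.2 hxy]; ring
    rw [this]
    exact div_mem (sub_mem (key x hxK hx) (key y hyK hy)) (sub_mem hxK hyK)
  have h0 : a 0 ∈ K := by
    have : a 0 = (a 0 + a 1 * x) - a 1 * x := by ring
    rw [this]
    exact sub_mem (key x hxK hx) (mul_mem h1 hxK)
  exact Fin.cases h0 (fun i => Fin.cases h1 hr i) i

/-- The members of the family with algebraically independent parameters have no multiple roots: a
multiple root would express the first two parameters by itself and the remaining parameters. -/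
theorem eval_derivative_familyPoly_ne_zero (hfg : IsCoprime f g) {a : Fin (n + 2) → E}
    (ha : AlgebraicIndependent F a) {x : E} (hx : (familyPoly f g a).eval x = 0) :
    (derivative (familyPoly f g a)).eval x ≠ 0 := by
  intro hx'
  -- A family with a repeated entry cannot be algebraically independent.
  suffices h : AlgebraicIndependent F (replaceTwo a x x) from
    absurd (h.injective (a₁ := 0) (a₂ := 1) rfl) (by simp)
  refine algebraicIndependent_of_isAlgebraic_adjoin ha fun i => ?_
  set K := IntermediateField.adjoin F (Set.range (replaceTwo a x x)) with hK
  suffices h : a i ∈ K from isAlgebraic_algebraMap (⟨a i, h⟩ : K)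
  have hmem : ∀ j, replaceTwo a x x j ∈ K := fun j => IntermediateField.subset_adjoin F _ ⟨j, rfl⟩
  have hxK : x ∈ K := hmem 0
  have hr : ∀ j : Fin n, a j.succ.succ ∈ K := fun j => hmem j.succ.succ
  have hg := aeval_ne_zero_of_eval_familyPoly_eq_zero hfg hx
  rw [eval_familyPoly] at hx
  rw [eval_derivative_familyPoly, derivative_sum_two_add] at hx'
  have hS : ∑ i, a i * x ^ (i : ℕ) = - (aeval x f / aeval x g) := by
    field_simp
    linear_combination hx
  have hSK : ∑ i, a i * x ^ (i : ℕ) ∈ K := by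
    rw [hS]
    exact neg_mem (div_mem (K.aeval_mem_of_mem hxK f) (K.aeval_mem_of_mem hxK g))
  have h1 : a 1 ∈ K := by
    have : a 1 = - ((aeval x (derivative f) + aeval x (derivative g) *
        (∑ i, a i * x ^ (i : ℕ))) / aeval x g) -
        ∑ i : Fin n, a i.succ.succ * ((((i : ℕ) + 2 : ℕ) : E) * x ^ ((i : ℕ) + 1)) := by
      rw [eq_sub_iff_add_eq, ← neg_div, eq_div_iff hg]
      linear_combination hx'
    rw [this]
    exact sub_mem (neg_mem (div_mem (add_mem (K.aeval_mem_of_mem hxK _)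
      (mul_mem (K.aeval_mem_of_mem hxK _) hSK)) (K.aeval_mem_of_mem hxK g)))
      (sum_mem fun j _ => mul_mem (hr j) (mul_mem (natCast_mem K _) (pow_mem hxK _)))
  have h0 : a 0 ∈ K := by
    have : a 0 = (∑ i, a i * x ^ (i : ℕ)) - a 1 * x -
        ∑ i : Fin n, a i.succ.succ * x ^ ((i : ℕ) + 2) := by
      rw [sum_two_add]; ring
    rw [this]
    exact sub_mem (sub_mem hSK (mul_mem h1 hxK)) (sum_mem fun j _ => mul_mem (hr j) (pow_mem hxK _))
  exact Fin.cases h0 (fun i => Fin.cases h1 hr i) i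

theorem separable_familyPoly (hfg : IsCoprime f g) {a : Fin (n + 2) → E}
    (ha : AlgebraicIndependent F a) : (familyPoly f g a).Separable := by
  let φ : E →ₐ[F] AlgebraicClosure E := IsScalarTower.toAlgHom F E (AlgebraicClosure E)
  have ha' : AlgebraicIndependent F (φ ∘ a) := ha.map' φ.injective
  rw [← separable_map φ.toRingHom, map_familyPoly, Polynomial.Separable,
    isCoprime_iff_aeval_ne_zero_of_isAlgClosed (AlgebraicClosure E) (AlgebraicClosure E)]
  intro x
  by_cases hx : (familyPoly f g (φ ∘ a)).eval x = 0
  · right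
    simpa using eval_derivative_familyPoly_ne_zero hfg ha' hx
  · left
    simpa using hx

end

/-! ### Double transitivity -/

/-- A bijection between a transcendence basis and an algebraically independent family in an
algebraically closed field extends to an embedding of fields. -/
theorem IsTranscendenceBasis.exists_algHom_of_algebraicIndependent {F Ω Ω' ι : Type*} [Field F]
    [Field Ω] [Field Ω'] [Algebra F Ω] [Algebra F Ω'] [IsAlgClosed Ω'] {b : ι → Ω} {b' : ι → Ω'}
    (hb : IsTranscendenceBasis F b) (hb' : AlgebraicIndependent F b') :
    ∃ τ : Ω →ₐ[F] Ω', ∀ i, τ (b i) = b' i := by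
  let : Algebra (MvPolynomial ι F) Ω := (MvPolynomial.aeval b).toAlgebra
  let : Algebra (MvPolynomial ι F) Ω' := (MvPolynomial.aeval b').toAlgebra
  have hinj : Function.Injective (algebraMap (MvPolynomial ι F) Ω) := hb.1
  have hinj' : Function.Injective (algebraMap (MvPolynomial ι F) Ω') := hb'
  have : FaithfulSMul (MvPolynomial ι F) Ω := (faithfulSMul_iff_algebraMap_injective _ _).2 hinj
  have : FaithfulSMul (MvPolynomial ι F) Ω' := (faithfulSMul_iff_algebraMap_injective _ _).2 hinj'
  have halg : Algebra.IsAlgebraic (MvPolynomial ι F) Ω := by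
    have h1 := hb.isAlgebraic
    exact h1.of_ringHom_of_comp_eq hb.1.aevalEquiv.toRingEquiv (RingEquiv.refl Ω)
      hb.1.aevalEquiv.surjective (RingEquiv.refl Ω).injective (by
        ext <;> simp [RingHom.algebraMap_toAlgebra] )
  let τ : Ω →ₐ[MvPolynomial ι F] Ω' := IsAlgClosed.lift
  have hτ : ∀ p, τ (MvPolynomial.aeval b p) = MvPolynomial.aeval b' p := τ.commutes
  refine ⟨{ (τ : Ω →+* Ω') with
    commutes' := fun c => ?_ }, fun i => ?_⟩
  · have := hτ (MvPolynomial.C c)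
    rwa [MvPolynomial.aeval_C, MvPolynomial.aeval_C] at this
  · simpa using! hτ (MvPolynomial.X i)

section
variable {F : Type*} [Field F] {n : ℕ} {f g : F[X]}

/-- The parameters form a transcendence basis of every algebraic extension of the parameter
field. -/
theorem isTranscendenceBasis_algebraMap_X (m : ℕ) (Ω : Type*) [Field Ω] [Algebra F Ω]
    [Algebra (ParamField F m) Ω] [IsScalarTower F (ParamField F m) Ω]
    [Algebra.IsAlgebraic (ParamField F m) Ω] :
    IsTranscendenceBasis F fun i : Fin (m + 1) => algebraMap (ParamField F m) Ω
      (algebraMap (MvPolynomial (Fin (m + 1)) F) (ParamField F m) (MvPolynomial.X i)) := by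
  have := IsLocalization.isAlgebraic (ParamField F m)
    (nonZeroDivisors (MvPolynomial (Fin (m + 1)) F))
  have h1 := (IsTranscendenceBasis.mvPolynomial (Fin (m + 1)) F).algebraMap_comp
    (A := ParamField F m)
  exact h1.algebraMap_comp (A := Ω)

theorem algebraicIndependent_algebraMap_X (m : ℕ) :
    AlgebraicIndependent F fun i : Fin (m + 1) =>
      algebraMap (MvPolynomial (Fin (m + 1)) F) (ParamField F m) (MvPolynomial.X i) :=
  (isTranscendenceBasis_algebraMap_X m (ParamField F m)).1

/-- Any pair of distinct roots of the generic polynomial can be moved to any other by an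
automorphism: both pairs complete the parameters of index at least two to a transcendence basis,
and the remaining two parameters are given in terms of either basis by the same formulas. -/
theorem exists_algEquiv_apply_eq (hfg : IsCoprime f g) (Ω : Type*) [Field Ω] [Algebra F Ω]
    [Algebra (ParamField F (n + 1)) Ω] [IsScalarTower F (ParamField F (n + 1)) Ω]
    [Normal (ParamField F (n + 1)) Ω] {x y x' y' : Ω}
    (hxy : x ≠ y) (hxy' : x' ≠ y')
    (hx : aeval x (genericPoly (n + 1) f g) = 0) (hy : aeval y (genericPoly (n + 1) f g) = 0)
    (hx' : aeval x' (genericPoly (n + 1) f g) = 0)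
    (hy' : aeval y' (genericPoly (n + 1) f g) = 0) :
    ∃ σ : Ω ≃ₐ[ParamField F (n + 1)] Ω, σ x = x' ∧ σ y = y' := by
  set K := ParamField F (n + 1)
  let ψ : K →ₐ[F] Ω := IsScalarTower.toAlgHom F K Ω
  set a : Fin (n + 2) → Ω := fun i => algebraMap K Ω
      (algebraMap (MvPolynomial (Fin (n + 2)) F) K (MvPolynomial.X i)) with ha_def
  have ha : IsTranscendenceBasis F a := isTranscendenceBasis_algebraMap_X (n + 1) Ω
  have hP : (genericPoly (n + 1) f g).map (algebraMap K Ω) = familyPoly f g a :=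
    map_familyPoly ψ _
  have hP' : ∀ z : Ω, aeval z (genericPoly (n + 1) f g) = 0 → (familyPoly f g a).eval z = 0 := by
    intro z hz
    rwa [← hP, eval_map_algebraMap]
  replace hx := hP' x hx
  replace hy := hP' y hy
  replace hx' := hP' x' hx'
  replace hy' := hP' y' hy'
  have hb := algebraicIndependent_replaceTwo hfg ha.1 hxy hx hy
  have hb' := algebraicIndependent_replaceTwo hfg ha.1 hxy' hx' hy'
  have hbt : IsTranscendenceBasis F (replaceTwo a x y) := by
    refine hb.isTranscendenceBasis_of_lift_trdeg_le_of_finite ?_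
    rw [← ha.lift_cardinalMk_eq_trdeg]
  let ι : Ω →ₐ[F] AlgebraicClosure Ω := IsScalarTower.toAlgHom F Ω (AlgebraicClosure Ω)
  obtain ⟨τ, hτ⟩ := hbt.exists_algHom_of_algebraicIndependent (hb'.map' (f := ι) ι.injective)
  have hτx : τ x = ι x' := hτ 0
  have hτy : τ y = ι y' := hτ 1
  have hτr : ∀ i : Fin n, τ (a i.succ.succ) = ι (a i.succ.succ) := fun i => hτ i.succ.succ
  -- At corresponding roots `z`, `z'`, the image under `τ` of the equation of `z` and the equation of
  -- `z'` differ only in the first two parameters.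
  have key : ∀ z z', τ z = ι z' → (familyPoly f g a).eval z = 0 →
      (familyPoly f g a).eval z' = 0 →
      τ (a 0) + τ (a 1) * ι z' = ι (a 0) + ι (a 1) * ι z' := by
    intro z z' hz h h'
    have hg : ι (aeval z' g) ≠ 0 := by
      simpa using aeval_ne_zero_of_eval_familyPoly_eq_zero hfg h'
    rw [eval_familyPoly, sum_two_add] at h h'
    have e := congrArg τ h
    have e' := congrArg ι h'
    simp only [map_add, map_mul, map_sum, map_pow, ← aeval_algHom_apply, map_zero, hz,
        hτr] at e e' hg
    refine mul_left_cancel₀ hg ?_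
    linear_combination e - e'
  have k1 := key x x' hτx hx hx'
  have k2 := key y y' hτy hy hy'
  have h1 : τ (a 1) = ι (a 1) := by
    have hne : ι x' - ι y' ≠ 0 := sub_ne_zero.2 (ι.injective.ne hxy')
    refine mul_right_cancel₀ hne ?_
    linear_combination k1 - k2
  have h0 : τ (a 0) = ι (a 0) := by
    rw [h1] at k1
    exact add_right_cancel k1
  have hall : ∀ i, τ (a i) = ι (a i) := fun i => Fin.cases h0 (fun i => Fin.cases h1 hτr i) i
  have hK : (τ.comp ψ : K →ₐ[F] _).toRingHom = (ι.comp ψ).toRingHom := by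
    refine IsLocalization.ringHom_ext (nonZeroDivisors (MvPolynomial (Fin (n + 2)) F)) ?_
    refine MvPolynomial.ringHom_ext (fun c => ?_) (fun i => hall i)
    have : ∀ χ : K →ₐ[F] AlgebraicClosure Ω, (χ.toRingHom.comp
        (algebraMap (MvPolynomial (Fin (n + 2)) F) K)) (MvPolynomial.C c) = algebraMap F _ c := by
      intro χ
      change χ (algebraMap _ K (algebraMap F (MvPolynomial (Fin (n + 2)) F) c)) = _
      rw [← IsScalarTower.algebraMap_apply, χ.commutes]
    rw [this, this]
  let τK : Ω →ₐ[K] AlgebraicClosure Ω := { τ.toRingHom with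
    commutes' := fun c => by
      rw [IsScalarTower.algebraMap_apply K Ω (AlgebraicClosure Ω)]
      exact RingHom.congr_fun hK c }
  refine ⟨τK.restrictNormal' Ω, ?_, ?_⟩
  · exact ι.injective ((τK.restrictNormal_commutes Ω x).trans hτx)
  · exact ι.injective ((τK.restrictNormal_commutes Ω y).trans hτy)

end

/-! ### Transpositions -/

/-- A doubly transitive group of permutations of a finite set that contains a transposition is the
full symmetric group, since it contains all conjugates of that transposition. -/
theorem Subgroup.eq_top_of_isSwap_mem {α : Type*} [Finite α] [DecidableEq α]
    (G : Subgroup (Equiv.Perm α))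
    (h2 : ∀ x y x' y' : α, x ≠ y → x' ≠ y' → ∃ σ ∈ G, σ x = x' ∧ σ y = y')
    {τ : Equiv.Perm α} (hτ : τ.IsSwap) (hτG : τ ∈ G) : G = ⊤ := by
  rw [eq_top_iff, ← Equiv.Perm.closure_isSwap, Subgroup.closure_le]
  rintro _ ⟨x', y', hne', rfl⟩
  obtain ⟨x, y, hne, rfl⟩ := hτ
  obtain ⟨σ, hσ, rfl, rfl⟩ := h2 x y x' y' hne hne'
  rw [Equiv.swap_apply_apply]
  exact G.mul_mem (G.mul_mem hσ hτG) (G.inv_mem hσ)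

theorem Equiv.Perm.IsSwap.trans_trans {α β : Type*} [DecidableEq α] [DecidableEq β]
    {τ : Equiv.Perm α} (hτ : τ.IsSwap) (e : α ≃ β) :
    Equiv.Perm.IsSwap ((e.symm.trans τ).trans e) := by
  obtain ⟨x, y, hne, rfl⟩ := hτ
  exact ⟨e x, e y, e.injective.ne hne, Equiv.symm_trans_swap_trans x y e⟩

section
variable {K : Type*} [Field K] (P : K[X])

/-- The permutation of the roots in a splitting field induced by an automorphism. -/
noncomputable def rootPerm (σ : P.Gal) : Equiv.Perm (P.rootSet P.SplittingField) :=
  MulAction.toPerm σ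

/-- The permutation representation is conjugate to the tautological one: Mathlib's action on the
roots in an arbitrary extension involves an unspecified embedding of the splitting field. -/
theorem exists_galRootPerm_eq : ∃ e : Equiv.Perm (P.rootSet P.SplittingField), ∀ σ,
    galRootPerm P σ = (e.symm.trans (rootPerm P σ)).trans e := by
  have : Fact ((P.map (algebraMap K P.SplittingField)).Splits) := ⟨SplittingField.splits P⟩
  exact ⟨Gal.rootsEquivRoots P P.SplittingField, fun σ => rfl⟩

theorem galRootPerm_injective : Function.Injective (galRootPerm P) := by
  have : Fact ((P.map (algebraMap K P.SplittingField)).Splits) := ⟨SplittingField.splits P⟩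
  exact Gal.galActionHom_injective P P.SplittingField

open Classical in
/-- If a separable polynomial of degree `k` has exactly `k - 2` roots in an extension `E` of the
base field, then its Galois group contains a transposition: an automorphism over `E` that moves
one of the two missing roots interchanges them. -/
theorem exists_isSwap_galRootPerm {E : Type*} [Field E] [Algebra K E] (hP : P.Separable)
    (hE : (P.rootSet E).ncard + 2 = P.natDegree) :
    ∃ σ : P.Gal, (galRootPerm P σ).IsSwap := by
  let Q := P.map (algebraMap K E)
  let M := Q.SplittingField
  have hsplit : (P.map (algebraMap K M)).Splits := by
    rw [IsScalarTower.algebraMap_eq K E M, ← Polynomial.map_map]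
    exact SplittingField.splits Q
  have : Fact ((P.map (algebraMap K M)).Splits) := ⟨hsplit⟩
  have : IsGalois E M := IsGalois.of_separable_splitting_field (p := Q) hP.map
  let φ : E →ₐ[K] M := IsScalarTower.toAlgHom K E M
  have hφ : Function.Injective φ := φ.injective
  have himg : φ '' P.rootSet E ⊆ P.rootSet M := by
    rintro _ ⟨r, hr, rfl⟩
    exact rootSet_mapsTo φ hr
  have hM : (P.rootSet M).ncard = P.natDegree := by
    rw [← Nat.card_coe_set_eq, Nat.card_eq_fintype_card, card_rootSet_eq_natDegree hP hsplit]
  have hlt : (φ '' P.rootSet E).ncard < (P.rootSet M).ncard := by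
    rw [Set.ncard_image_of_injective _ hφ]; omega
  obtain ⟨ρ, hρ, hρE⟩ := Set.exists_mem_notMem_of_ncard_lt_ncard hlt
  have hρE' : ρ ∉ (⊥ : IntermediateField E M) := by
    rintro ⟨r, hr : φ r = ρ⟩
    have h := mem_rootSet.1 hρ
    rw [← hr, aeval_algHom_apply] at h
    exact hρE ⟨r, mem_rootSet.2 ⟨h.1, hφ (h.2.trans (map_zero φ).symm)⟩, hr⟩
  rw [IsGalois.mem_bot_iff_fixed] at hρE'
  push Not at hρE'
  obtain ⟨σ, hσ⟩ := hρE'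
  let π := Gal.galActionHom P M (Gal.restrict P M (σ.restrictScalars K))
  have hπ : ∀ x : P.rootSet M, ((π x : P.rootSet M) : M) = σ x := fun x =>
    Gal.galActionHom_restrict P M _ x
  have hπ1 : π ≠ 1 := by
    intro h
    apply hσ
    rw [← hπ ⟨ρ, hρ⟩, h]
    rfl
  have hsupp : (π.support.image Subtype.val : Set M) ⊆ P.rootSet M \ φ '' P.rootSet E := by
    intro z hz
    simp only [Finset.coe_image, Set.mem_image, Finset.mem_coe, Equiv.Perm.mem_support] at hz
    obtain ⟨x, hx, rfl⟩ := hz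
    refine ⟨x.2, ?_⟩
    rintro ⟨r, hr, hrx⟩
    refine hx (Subtype.ext ?_)
    rw [hπ, ← hrx]
    exact σ.commutes r
  have hcard : π.support.card ≤ 2 := by
    have h := Set.ncard_le_ncard hsupp
    rw [Set.ncard_coe_finset, Finset.card_image_of_injective _ Subtype.val_injective,
      Set.ncard_sdiff himg, Set.ncard_image_of_injective _ hφ] at h
    omega
  have hπs : π.IsSwap := Equiv.Perm.card_support_eq_two.1
    (hcard.antisymm (Equiv.Perm.two_le_card_support_of_ne_one hπ1))
  obtain ⟨e, he⟩ := exists_galRootPerm_eq P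
  refine ⟨Gal.restrict P M (σ.restrictScalars K), ?_⟩
  rw [he]
  refine Equiv.Perm.IsSwap.trans_trans ?_ e
  have h := hπs.trans_trans (Gal.rootsEquivRoots P M).symm
  convert h using 1
  ext x : 1
  change _ = (Gal.rootsEquivRoots P M).symm (Gal.rootsEquivRoots P M _)
  rw [Equiv.symm_apply_apply]
  change _ = _ • (Gal.rootsEquivRoots P M).symm (Gal.rootsEquivRoots P M x)
  rw [Equiv.symm_apply_apply]
  rfl

end

/-- The Galois group of the generic polynomial is the full symmetric group as soon as, over some
extension of the base field, a member of the family with algebraically independent parameters has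
all but two of its roots in that extension. -/
theorem galoisGroupIsSymmetric_of_ncard_rootSet {F E : Type*} [Field F] [Field E] [Algebra F E]
    {n k : ℕ} {f g : F[X]} (hfg : IsCoprime f g) (hf : f.natDegree = k)
    (hg : g.natDegree + (n + 1) < k) {a : Fin (n + 2) → E} (ha : AlgebraicIndependent F a)
    (hE : {r : E | (familyPoly f g a).eval r = 0}.ncard + 2 = k) :
    GaloisGroupIsSymmetric (genericPoly (n + 1) f g) k := by
  classical
  have hdeg : (genericPoly (n + 1) f g).natDegree = k := by
    rw [genericPoly_eq_familyPoly, natDegree_familyPoly (by omega) (by omega), hf]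
  have hsep : (genericPoly (n + 1) f g).Separable := by
    rw [genericPoly_eq_familyPoly]
    exact separable_familyPoly hfg (algebraicIndependent_algebraMap_X _)
  have hP0 : genericPoly (n + 1) f g ≠ 0 := hsep.ne_zero
  refine ⟨hdeg, hsep, galRootPerm_injective _, ?_⟩
  have hinj : Function.Injective (MvPolynomial.aeval a : MvPolynomial (Fin (n + 2)) F →ₐ[F] E) := ha
  let θ : ParamField F (n + 1) →ₐ[F] E := IsFractionRing.liftAlgHom hinj
  have hθ : ∀ p : MvPolynomial (Fin (n + 2)) F, θ (algebraMap _ _ p) = MvPolynomial.aeval a p :=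
    fun p => IsFractionRing.lift_algebraMap hinj p
  let : Algebra (ParamField F (n + 1)) E := θ.toRingHom.toAlgebra
  have hmap : (genericPoly (n + 1) f g).map (algebraMap (ParamField F (n + 1)) E) =
      familyPoly f g a := by
    rw [genericPoly_eq_familyPoly]
    refine (map_familyPoly θ _).trans ?_
    congr 1
    ext i
    simp [hθ]
  have hroots : (genericPoly (n + 1) f g).rootSet E = {r : E | (familyPoly f g a).eval r = 0} := by
    ext r
    rw [mem_rootSet, ← hmap, Set.mem_ofPred, eval_map_algebraMap]
    exact and_iff_right hP0
  obtain ⟨τ, hτ⟩ := exists_isSwap_galRootPerm (E := E) _ hsep (by rw [hroots, hE, hdeg])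
  rw [← MonoidHom.range_eq_top]
  refine Subgroup.eq_top_of_isSwap_mem _ ?_ hτ ⟨τ, rfl⟩
  obtain ⟨e, he⟩ := exists_galRootPerm_eq (genericPoly (n + 1) f g)
  intro x y x' y' hxy hxy'
  have hroot : ∀ z : (genericPoly (n + 1) f g).rootSet (genericPoly (n + 1) f g).SplittingField,
      aeval (z : (genericPoly (n + 1) f g).SplittingField) (genericPoly (n + 1) f g) = 0 :=
    fun z => (mem_rootSet.1 z.2).2
  obtain ⟨σ, hσx, hσy⟩ := exists_algEquiv_apply_eq hfg (genericPoly (n + 1) f g).SplittingField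
    (Subtype.coe_injective.ne (e.symm.injective.ne hxy))
    (Subtype.coe_injective.ne (e.symm.injective.ne hxy'))
    (hroot _) (hroot _) (hroot _) (hroot _)
  refine ⟨_, ⟨σ, rfl⟩, ?_, ?_⟩
  · exact (DFunLike.congr_fun (he σ) x).trans
      (e.eq_symm_apply.1 (Subtype.ext hσx))
  · exact (DFunLike.congr_fun (he σ) y).trans
      (e.eq_symm_apply.1 (Subtype.ext hσy))

/-! ### Hensel's lemma and Laurent series -/

section
variable {L : Type*} [Field L]

/-- The deformation `P + s * g` of a polynomial `P` over `L`, as a polynomial over the ring of power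
series in `s`. -/
noncomputable def deformation (P g : L[X]) : (PowerSeries L)[X] :=
  P.map PowerSeries.C + C PowerSeries.X * g.map PowerSeries.C

variable {P g : L[X]}

theorem map_constantCoeff_deformation :
    (deformation P g).map PowerSeries.constantCoeff = P := by
  have : (PowerSeries.constantCoeff (R := L)).comp PowerSeries.C = RingHom.id L := by ext; simp
  simp [deformation, Polynomial.map_map, this]

theorem constantCoeff_eval_deformation (ρ : PowerSeries L) :
    PowerSeries.constantCoeff ((deformation P g).eval ρ) =
      P.eval (PowerSeries.constantCoeff ρ) := by
  conv_rhs => rw [← map_constantCoeff_deformation (P := P) (g := g)]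
  rw [eval_map_apply]

theorem degree_C_X_mul_map_lt (h : g.natDegree < P.natDegree) :
    (C PowerSeries.X * g.map PowerSeries.C : (PowerSeries L)[X]).degree <
      (P.map (PowerSeries.C : L →+* PowerSeries L)).degree := by
  apply degree_lt_degree
  rw [natDegree_map_eq_of_injective PowerSeries.C_injective]
  exact ((natDegree_C_mul_le _ _).trans natDegree_map_le).trans_lt h

theorem monic_deformation (h : g.natDegree < P.natDegree) (hP : P.Monic) :
    (deformation P g).Monic :=
  (hP.map _).add_of_left (degree_C_X_mul_map_lt h)

theorem deformation_C_mul (c : L) :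
    deformation (C c * P) (C c * g) = C (PowerSeries.C c) * deformation P g := by
  simp [deformation]; ring

/-- Hensel's lemma for a simple root of `P`. -/
theorem exists_root_deformation (h : g.natDegree < P.natDegree) {r : L} (hr : P.eval r = 0)
    (hr' : (derivative P).eval r ≠ 0) :
    ∃ ρ : PowerSeries L, (deformation P g).eval ρ = 0 ∧ PowerSeries.constantCoeff ρ = r := by
  have hP : P ≠ 0 := by rintro rfl; simp at h
  -- Mathlib's form of Hensel's lemma is for monic polynomials.
  have hc : P.leadingCoeff⁻¹ ≠ 0 := inv_ne_zero (leadingCoeff_ne_zero.2 hP)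
  set c := P.leadingCoeff⁻¹
  have hmonic : (C c * P).Monic := monic_C_mul_of_mul_leadingCoeff_eq_one
    (inv_mul_cancel₀ (leadingCoeff_ne_zero.2 hP))
  have hm := monic_deformation (P := C c * P) (g := C c * g)
    (by rwa [natDegree_C_mul hc, natDegree_C_mul hc]) hmonic
  have hmem : ∀ z : PowerSeries L, z ∈ Ideal.span {(PowerSeries.X : PowerSeries L)} ↔
      PowerSeries.constantCoeff z = 0 := fun z => by
    rw [Ideal.mem_span_singleton, PowerSeries.X_dvd_iff]
  obtain ⟨ρ, hρ, hρ'⟩ := HenselianRing.is_henselian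
    (I := Ideal.span {(PowerSeries.X : PowerSeries L)}) _ hm (PowerSeries.C r)
    (by rw [hmem, constantCoeff_eval_deformation]; simp [hr])
    (by
      refine IsUnit.map _ (PowerSeries.isUnit_iff_constantCoeff.2 ?_)
      rw [← eval_map_apply, ← derivative_map, map_constantCoeff_deformation]
      simpa using ⟨hc, hr'⟩)
  refine ⟨ρ, ?_, ?_⟩
  · rw [Polynomial.IsRoot, deformation_C_mul, eval_mul, eval_C] at hρ
    exact (mul_eq_zero.1 hρ).resolve_left (by simpa using hc)
  · rw [hmem] at hρ'
    simpa [sub_eq_zero] using hρ'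

/-- Uniqueness in Hensel's lemma for a simple root of `P`. -/
theorem root_deformation_unique {ρ ρ' : PowerSeries L} (hρ : (deformation P g).eval ρ = 0)
    (hρ' : (deformation P g).eval ρ' = 0)
    (h : PowerSeries.constantCoeff ρ = PowerSeries.constantCoeff ρ')
    (hr' : (derivative P).eval (PowerSeries.constantCoeff ρ') ≠ 0) : ρ = ρ' := by
  obtain ⟨z, hz⟩ := (deformation P g).binomExpansion ρ' (ρ - ρ')
  rw [add_sub_cancel, hρ, hρ', zero_add] at hz
  have h1 : ((derivative (deformation P g)).eval ρ' + z * (ρ - ρ')) * (ρ - ρ') = 0 := by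
    rw [hz]; ring
  refine sub_eq_zero.1 ((mul_eq_zero.1 h1).resolve_left fun h2 => hr' ?_)
  have := congrArg PowerSeries.constantCoeff h2
  simpa [h, ← eval_map_apply, ← derivative_map, map_constantCoeff_deformation] using this

/-- A double root of `P` at which `g` does not vanish does not lift to a root of the
deformation. -/
theorem eval_deformation_ne_zero {x : L} {h : L[X]} (hP : P = (X - C x) ^ 2 * h)
    (hg : g.eval x ≠ 0) {ρ : PowerSeries L} (hρ : PowerSeries.constantCoeff ρ = x) :
    (deformation P g).eval ρ ≠ 0 := by
  intro h0
  -- With `ρ = x + s * δ` the value of the deformation at `ρ` is `s * g x` modulo `s ^ 2`.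
  obtain ⟨δ, hδ⟩ : PowerSeries.X ∣ ρ - PowerSeries.C x := by
    rw [PowerSeries.X_dvd_iff]; simp [hρ]
  rw [deformation, hP] at h0
  simp only [Polynomial.map_mul, Polynomial.map_pow, Polynomial.map_sub, map_X, map_C, eval_add,
    eval_mul, eval_pow, eval_sub, eval_X, eval_C, hδ] at h0
  have h1 : PowerSeries.X * δ ^ 2 * (h.map PowerSeries.C).eval ρ +
      (g.map PowerSeries.C).eval ρ = 0 := by
    refine mul_left_cancel₀ (PowerSeries.X_ne_zero (R := L)) ?_
    linear_combination h0
  have h2 := congrArg PowerSeries.constantCoeff h1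
  rw [map_add, mul_assoc, map_mul, PowerSeries.constantCoeff_X, zero_mul, zero_add,
    ← eval_map_apply, Polynomial.map_map, hρ, map_zero] at h2
  have : (PowerSeries.constantCoeff (R := L)).comp PowerSeries.C = RingHom.id L := by ext; simp
  rw [this, Polynomial.map_id] at h2
  exact hg h2

/-- If `P = (X - x) ^ 2 * h` with `h` separable and `h x ≠ 0 ≠ g x`, then the roots of `P + s * g`
in the field of Laurent series in `s` are exactly the lifts of the roots of `h`. -/
theorem ncard_roots_deformation [IsAlgClosed L] (E : Type*) [Field E] [Algebra (PowerSeries L) E]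
    [IsFractionRing (PowerSeries L) E] {x : L} {h : L[X]} (hP : P = (X - C x) ^ 2 * h)
    (hsep : h.Separable) (hh : h.eval x ≠ 0) (hg : g.eval x ≠ 0)
    (hdeg : g.natDegree < P.natDegree) :
    {r : E | ((deformation P g).map (algebraMap (PowerSeries L) E)).eval r = 0}.ncard + 2 =
      P.natDegree := by
  classical
  have hP0 : P ≠ 0 := by rintro rfl; simp at hdeg
  have hPder : ∀ r, r ≠ x → h.eval r = 0 → (derivative P).eval r ≠ 0 := by
    intro r hrx hr h0
    have h1 : (derivative P).eval r = (r - x) ^ 2 * (derivative h).eval r := by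
      rw [hP]; simp [hr]
    rw [h1] at h0
    exact hsep.eval₂_derivative_ne_zero (RingHom.id L) (by simpa [eval₂_id] using hr)
      (by simpa [eval₂_id] using (mul_eq_zero.1 h0).resolve_left (pow_ne_zero 2 (sub_ne_zero.2 hrx)))
  have hroot : ∀ ρ : PowerSeries L, (deformation P g).eval ρ = 0 →
      PowerSeries.constantCoeff ρ ≠ x ∧ h.eval (PowerSeries.constantCoeff ρ) = 0 := by
    intro ρ hρ
    have hne : PowerSeries.constantCoeff ρ ≠ x := fun hx => eval_deformation_ne_zero hP hg hx hρ
    refine ⟨hne, ?_⟩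
    have h1 := constantCoeff_eval_deformation (P := P) (g := g) ρ
    rw [hρ, map_zero, hP] at h1
    simpa [sub_eq_zero, hne] using h1.symm
  have hE : {r : E | ((deformation P g).map (algebraMap (PowerSeries L) E)).eval r = 0} =
      algebraMap (PowerSeries L) E '' {ρ | (deformation P g).eval ρ = 0} := by
    ext r
    constructor
    · intro hr
      have hunit : IsUnit (deformation P g).leadingCoeff := by
        rw [deformation, leadingCoeff_add_of_degree_lt' (degree_C_X_mul_map_lt hdeg),
          leadingCoeff_map_of_injective PowerSeries.C_injective]
        exact (IsUnit.mk0 _ (leadingCoeff_ne_zero.2 hP0)).map _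
      have hint : IsIntegral (PowerSeries L) r := by
        obtain ⟨u, hu⟩ := hunit
        refine ⟨C (↑u⁻¹ : PowerSeries L) * deformation P g, ?_, ?_⟩
        · apply monic_C_mul_of_mul_leadingCoeff_eq_one
          rw [← hu, Units.inv_mul]
        · rw [eval₂_mul, ← eval_map, ← eval_map]
          exact mul_eq_zero_of_right _ hr
      obtain ⟨ρ, rfl⟩ := IsIntegrallyClosed.isIntegral_iff.1 hint
      refine ⟨ρ, ?_, rfl⟩
      rw [Set.mem_ofPred, eval_map_apply] at hr
      exact (map_eq_zero_iff _ (IsFractionRing.injective (PowerSeries L) E)).1 hr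
    · rintro ⟨ρ, hρ, rfl⟩
      rw [Set.mem_ofPred, eval_map_apply, Set.mem_ofPred.1 hρ, map_zero]
  have himg : PowerSeries.constantCoeff '' {ρ | (deformation P g).eval ρ = 0} =
      (h.roots.toFinset : Set L) := by
    ext r
    simp only [Finset.mem_coe, Multiset.mem_toFinset, mem_roots hsep.ne_zero, IsRoot.def]
    constructor
    · rintro ⟨ρ, hρ, rfl⟩
      exact (hroot ρ hρ).2
    · intro hr
      have hrx : r ≠ x := by rintro rfl; exact hh hr
      exact exists_root_deformation hdeg (by rw [hP]; simp [hr]) (hPder r hrx hr)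
  have hinj : Set.InjOn PowerSeries.constantCoeff {ρ | (deformation P g).eval ρ = 0} := by
    intro ρ hρ ρ' hρ' he
    exact root_deformation_unique hρ hρ' he
      (hPder _ (hroot ρ' hρ').1 (hroot ρ' hρ').2)
  rw [hE, Set.ncard_image_of_injective _ (IsFractionRing.injective (PowerSeries L) E),
    ← hinj.ncard_image, himg, Set.ncard_coe_finset,
    Multiset.toFinset_card_of_nodup (nodup_roots hsep), hP,
    natDegree_mul (pow_ne_zero 2 (X_sub_C_ne_zero x)) hsep.ne_zero, natDegree_pow,
    natDegree_X_sub_C, (IsAlgClosed.splits h).natDegree_eq_card_roots]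
  ring

end

/-! ### Members of the family with a unique double root -/

/-- The member of the family with parameters `a` has exactly one multiple root, of multiplicity
exactly two, and `g` does not vanish there. -/
def HasUniqueDoubleRoot {F L : Type*} [Field F] [Field L] [Algebra F L] {n : ℕ} (f g : F[X])
    (a : Fin n → L) : Prop :=
  ∃ (x : L) (h : L[X]), familyPoly f g a = (X - C x) ^ 2 * h ∧ h.Separable ∧ h.eval x ≠ 0 ∧
    aeval x g ≠ 0

theorem transcendental_powerSeries_X (L : Type*) [Field L] :
    Transcendental L (PowerSeries.X : PowerSeries L) := by
  rw [transcendental_iff]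
  intro p hp
  have h : ∀ q : L[X], aeval (PowerSeries.X : PowerSeries L) q = (q : PowerSeries L) := by
    intro q
    induction q using Polynomial.induction_on' with
    | add p q hp hq => simp [hp, hq]
    | monomial n c =>
      rw [aeval_monomial, ← C_mul_X_pow_eq_monomial, Polynomial.coe_mul, Polynomial.coe_C,
        Polynomial.coe_pow, Polynomial.coe_X, PowerSeries.algebraMap_apply,
        Algebra.algebraMap_self_apply]
  rw [h] at hp
  exact Polynomial.coe_injective L (hp.trans Polynomial.coe_zero.symm)

/-- Adding to the constant parameter a variable that is transcendental over all the others turns a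
member of the family with a unique double root into one with algebraically independent parameters,
all but two of whose roots are Laurent series in that variable. -/
theorem HasUniqueDoubleRoot.exists_ncard_roots {F L : Type*} [Field F] [Field L] [Algebra F L]
    [IsAlgClosed L] {n : ℕ} {f g : F[X]} (hg : g.natDegree + (n + 1) < f.natDegree)
    {a : Fin (n + 2) → L} (h : HasUniqueDoubleRoot f g a)
    (ha : AlgebraicIndependent F (a ∘ Fin.succ)) :
    ∃ b : Fin (n + 2) → FractionRing (PowerSeries L), AlgebraicIndependent F b ∧
      {r | (familyPoly f g b).eval r = 0}.ncard + 2 = f.natDegree := by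
  obtain ⟨x, h, hP, hsep, hh, hgx⟩ := h
  set E := FractionRing (PowerSeries L)
  let ι : L →ₐ[F] E := IsScalarTower.toAlgHom F L E
  let s : E := algebraMap (PowerSeries L) E PowerSeries.X
  let b : Fin (n + 2) → E := Fin.cons (ι (a 0) + s) fun i => ι (a i.succ)
  have hs : Transcendental L (ι (a 0) + s) := by
    have h1 : Transcendental L s :=
      (transcendental_algebraMap_iff (IsFractionRing.injective (PowerSeries L) E)).2
        (transcendental_powerSeries_X L)
    intro halg
    refine h1 ?_
    have h2 : s = (ι (a 0) + s) - algebraMap L E (a 0) := by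
      simp [ι]
    rw [h2]
    exact halg.sub (isAlgebraic_algebraMap _)
  refine ⟨b, ?_, ?_⟩
  · have h1 : AlgebraicIndependent L fun _ : Unit => ι (a 0) + s :=
      algebraicIndependent_unique_type_iff.2 hs
    have h2 := ha.sumElim_comp h1
    let e : Fin (n + 2) → Unit ⊕ Fin (n + 1) := Fin.cons (Sum.inl ()) Sum.inr
    have he : Function.Injective e :=
      Fin.cons_injective_iff.2 ⟨by simp, Sum.inr_injective⟩
    convert h2.comp e he using 1
    ext i
    refine Fin.cases ?_ (fun i => ?_) i <;> simp [b, e, ι]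
  · have hdeg := natDegree_familyPoly (f := f) (g := g) (a := a) (by omega) (by omega)
    have hmapC : (algebraMap (PowerSeries L) E).comp PowerSeries.C = ι.toRingHom := rfl
    have hfam : familyPoly f g b = (deformation (familyPoly f g a) (g.map (algebraMap F L))).map
        (algebraMap (PowerSeries L) E) := by
      have h3 : (g.map (algebraMap F L)).map ι.toRingHom = g.map (algebraMap F E) := by
        rw [Polynomial.map_map]; congr 1; exact ι.comp_algebraMap
      rw [deformation, Polynomial.map_add, Polynomial.map_mul, Polynomial.map_map,
        Polynomial.map_map, hmapC, map_familyPoly, h3, map_C]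
      simp only [familyPoly, Fin.sum_univ_succ (n := n + 1), b, Fin.cons_zero, Fin.cons_succ,
        Function.comp, C_add, Fin.val_zero, pow_zero]
      ring
    have h4 := ncard_roots_deformation E hP hsep hh
      (g := g.map (algebraMap F L)) (by rwa [eval_map_algebraMap])
      (by rw [hdeg, natDegree_map]; omega)
    rw [← hfam, hdeg] at h4
    exact h4

/-! ### A generic double root with three parameters -/

theorem Polynomial.sq_X_sub_C_dvd {K : Type*} [Field K] {Q : K[X]} {x : K} (h : Q.eval x = 0)
    (h' : (derivative Q).eval x = 0) : (X - C x) ^ 2 ∣ Q := by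
  obtain ⟨q, rfl⟩ := dvd_iff_isRoot.2 h
  obtain ⟨r, rfl⟩ := dvd_iff_isRoot.2 (show q.eval x = 0 by simpa using h')
  exact ⟨r, by ring⟩

section
variable {F K : Type*} [Field F] [Field K] [Algebra F K] {f g : F[X]}

theorem aeval_ne_zero_of_transcendental {x : K} (hx : Transcendental F x) {p : F[X]}
    (hp : p ≠ 0) :
    aeval x p ≠ 0 := fun h => hp (transcendental_iff.1 hx p h)

/-- Subtracting the tangent of `f / g` at a generic point `x` leaves `(X - x) ^ 2 * h / g`. Here
`h` is prime to `g`, and `h / g` has nonzero derivative: otherwise both `g` and `h` would have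
derivative zero, so that `f' = 2 * (X - x) * h + c * g` for a constant `c` and `f'' = 2 * h`. In
characteristic two, `f / g` would then have constant derivative. In other characteristics, `x` could
be expressed by coefficients of `f`. -/
theorem exists_eq_sq_mul_add_tangent (hfg : IsCoprime f g)
    (hdeg : g.natDegree + 2 < f.natDegree)
    (hW : (2 : F) = 0 → ∀ c, derivative f * g - f * derivative g ≠ C c * g ^ 2)
    {x : K} (hx : Transcendental F x) :
    ∃ h : K[X], f.map (algebraMap F K) = (X - C x) ^ 2 * h + g.map (algebraMap F K) *
        (C (aeval x f / aeval x g) + C (aeval x (derivative f * g - f * derivative g) /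
          aeval x g ^ 2) * (X - C x)) ∧
      IsCoprime h (g.map (algebraMap F K)) ∧
      derivative h * g.map (algebraMap F K) - h * derivative (g.map (algebraMap F K)) ≠ 0 := by
  have hg0 : g ≠ 0 := by
    rintro rfl
    rw [isCoprime_zero_right] at hfg
    rw [natDegree_eq_zero_of_isUnit hfg] at hdeg
    omega
  have hgx := aeval_ne_zero_of_transcendental hx hg0
  set φ₀ := aeval x f / aeval x g with hφ₀
  set φ₁ := aeval x (derivative f * g - f * derivative g) / aeval x g ^ 2 with hφ₁
  set f' := f.map (algebraMap F K) with hf'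
  set g' := g.map (algebraMap F K) with hg'
  have hg'0 : g' ≠ 0 := by rwa [Ne, Polynomial.map_eq_zero]
  have hdvd : (X - C x) ^ 2 ∣ f' - g' * (C φ₀ + C φ₁ * (X - C x)) := by
    apply sq_X_sub_C_dvd
    · simp only [hf', hg', eval_sub, eval_map_algebraMap, eval_mul, eval_add, eval_C, eval_X, hφ₀]
      field_simp
      ring
    · simp only [hf', hg', derivative_mul, derivative_add, derivative_C, eval_sub,
        derivative_map, eval_map_algebraMap, eval_mul, eval_add, eval_C, eval_X, hφ₀, hφ₁,
        derivative_X, map_sub, map_mul, eval_zero, eval_one]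
      field_simp
      ring
  obtain ⟨h, hh⟩ := hdvd
  have hfh : f' = (X - C x) ^ 2 * h + g' * (C φ₀ + C φ₁ * (X - C x)) := by
    linear_combination hh
  have hcop : IsCoprime h g' := by
    have h1 : IsCoprime f' g' := hfg.map (mapRingHom (algebraMap F K))
    rw [hfh, IsCoprime.add_mul_left_left_iff] at h1
    exact h1.of_mul_left_right
  refine ⟨h, hfh, hcop, fun hwr => ?_⟩
  have hder : derivative g' = 0 := by
    rw [← dvd_derivative_iff]
    refine hcop.symm.dvd_of_dvd_mul_left ⟨derivative h, ?_⟩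
    linear_combination -hwr
  have hder' : derivative h = 0 := by
    rw [hder, mul_zero, sub_zero] at hwr
    exact (mul_eq_zero.1 hwr).resolve_right hg'0
  have hgder : derivative g = 0 := by
    rwa [hg', derivative_map, Polynomial.map_eq_zero] at hder
  have hf1 : derivative f' = 2 * (X - C x) * h + C φ₁ * g' := by
    rw [hfh]
    simp only [derivative_add, derivative_mul, derivative_pow, hder, hder', derivative_sub,
      derivative_C, derivative_X]
    norm_num
    simp only [map_ofNat]
    ring
  by_cases h2 : (2 : F) = 0
  · have h2' : (2 : K[X]) = 0 := by
      rw [← map_ofNat (algebraMap F K[X]) 2, h2, map_zero]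
    rw [h2', zero_mul, zero_mul, zero_add] at hf1
    have hφ : φ₁ = algebraMap F K ((derivative f).coeff g.natDegree / g.leadingCoeff) := by
      have := congrArg (fun p => coeff p g.natDegree) hf1
      simp only [hf', hg', derivative_map, coeff_map, coeff_C_mul, coeff_natDegree] at this
      rw [map_div₀, this, mul_div_cancel_right₀]
      simpa using hg0
    apply hW h2 ((derivative f).coeff g.natDegree / g.leadingCoeff)
    apply map_injective (algebraMap F K) (algebraMap F K).injective
    rw [hgder, mul_zero, sub_zero, Polynomial.map_mul, Polynomial.map_mul, Polynomial.map_pow,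
      map_C, ← derivative_map, ← hφ, ← hf', ← hg', hf1]
    ring
  · -- The coefficient of `X ^ deg h` in `f' = (X - x) * f'' + φ₁ * g` has no contribution from `g`,
    -- and that of `f''` is nonzero, which gives a formula for `x`.
    have hf2 : derivative (derivative f') = 2 * h := by
      rw [hf1]
      simp only [derivative_add, derivative_mul, derivative_C, hder, hder', derivative_sub,
        derivative_X, derivative_ofNat]
      ring
    have hdegP : ((X - C x) ^ 2 * h).natDegree = f.natDegree := by
      rw [← hh, natDegree_sub_eq_left_of_natDegree_lt, hf', natDegree_map]
      rw [hf', natDegree_map, hg']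
      have hlin : (C φ₀ + C φ₁ * (X - C x)).natDegree ≤ 1 := by compute_degree
      exact (natDegree_mul_le_of_le natDegree_map_le hlin).trans_lt (by omega)
    have hh0 : h ≠ 0 := by
      rintro rfl
      rw [mul_zero, natDegree_zero] at hdegP
      omega
    have hdegh : h.natDegree + 2 = f.natDegree := by
      rw [natDegree_mul (pow_ne_zero 2 (X_sub_C_ne_zero x)) hh0, natDegree_pow,
        natDegree_X_sub_C] at hdegP
      omega
    obtain ⟨N, hN⟩ : ∃ N, h.natDegree = N + 1 := ⟨h.natDegree - 1, by omega⟩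
    have hlead : algebraMap F K ((derivative (derivative f)).coeff (N + 1)) ≠ 0 := by
      rw [← coeff_map, ← derivative_map, ← derivative_map, ← hf', hf2, ← hN, coeff_ofNat_mul,
        coeff_natDegree]
      refine mul_ne_zero (fun h3 => h2 ?_) (leadingCoeff_ne_zero.2 hh0)
      rw [← map_eq_zero (algebraMap F K), map_ofNat]
      exact h3
    have hcoef : algebraMap F K ((derivative f).coeff (N + 1)) =
        algebraMap F K ((derivative (derivative f)).coeff N) -
          x * algebraMap F K ((derivative (derivative f)).coeff (N + 1)) := by
      have h3 : derivative f' = X * derivative (derivative f') - C x * derivative (derivative f')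
          + C φ₁ * g' := by rw [hf2, hf1]; ring
      have h4 := congrArg (fun p => coeff p (N + 1)) h3
      have h5 : g.coeff (N + 1) = 0 := coeff_eq_zero_of_natDegree_lt (by omega)
      simpa only [coeff_add, coeff_sub, coeff_X_mul, coeff_C_mul, hf', hg', derivative_map,
        coeff_map, h5, map_zero, mul_zero, add_zero] using h4
    refine hx ?_
    have hxe : x = algebraMap F K (((derivative (derivative f)).coeff N -
        (derivative f).coeff (N + 1)) / (derivative (derivative f)).coeff (N + 1)) := by
      rw [map_div₀, map_sub, eq_div_iff hlead]
      linear_combination hcoef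
    rw [hxe]
    exact isAlgebraic_algebraMap _

/-- A generic member of a pencil `h + A * g` with `h` prime to `g` and `h / g` of nonzero derivative
is separable, since a multiple root is a zero of the Wronskian, hence algebraic over the field of
coefficients, and determines `A`. -/
theorem separable_map_add_C_mul {L : Type*} [Field L] [IsAlgClosed L] [Algebra K L] {h g : K[X]}
    (hcop : IsCoprime h g) (hwr : derivative h * g - h * derivative g ≠ 0) {A : L}
    (hA : Transcendental K A) :
    (h.map (algebraMap K L) + C A * g.map (algebraMap K L)).Separable := by
  rw [Polynomial.Separable, isCoprime_iff_aeval_ne_zero_of_isAlgClosed L L]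
  intro y
  by_contra! hy
  obtain ⟨h1, h2⟩ := hy
  simp only [coe_aeval_eq_eval, eval_add, eval_mul, eval_C, eval_map_algebraMap, derivative_add,
    derivative_mul, derivative_C, derivative_map, zero_mul, zero_add] at h1 h2
  have hgy : aeval y g ≠ 0 := by
    intro h3
    rw [h3, mul_zero, add_zero] at h1
    obtain ⟨u, v, huv⟩ := hcop
    simpa [h1, h3] using congrArg (aeval y) huv
  have hyalg : IsAlgebraic K y := by
    refine ⟨_, hwr, ?_⟩
    simp only [map_sub, map_mul]
    linear_combination aeval y g * h2 - aeval y (derivative g) * h1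
  apply hA
  have hAe : A = - aeval y h / aeval y g := by
    rw [eq_div_iff hgy]; linear_combination h1
  have hal : ∀ p : K[X], IsAlgebraic K (aeval y p) := fun p =>
    mem_algebraicClosure_iff.1 ((algebraicClosure K L).aeval_mem_of_mem
      (mem_algebraicClosure_iff.2 hyalg) p)
  rw [hAe, div_eq_mul_inv]
  exact (hal h).neg.mul (hal g).inv

end

/-- For three parameters there is a generic member of the family with a unique double root. The
last two of its parameters are algebraically independent because together with the double root `x`
they satisfy the equation `(f / g)' + A₁ + 2 * A₂ * x = 0`. -/
theorem exists_hasUniqueDoubleRoot_three.{u} {F : Type u} [Field F] {f g : F[X]}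
    (hfg : IsCoprime f g) (hdeg : g.natDegree + 2 < f.natDegree)
    (hW : (2 : F) = 0 → ∀ c, derivative f * g - f * derivative g ≠ C c * g ^ 2) :
    ∃ (L : Type u) (_ : Field L) (_ : IsAlgClosed L) (_ : Algebra F L) (a₀ a₁ a₂ : L),
      HasUniqueDoubleRoot f g ![a₀, a₁, a₂] ∧ AlgebraicIndependent F ![a₁, a₂] := by
  let M := FractionRing (MvPolynomial (Fin 2) F)
  let L := AlgebraicClosure M
  let v : Fin 2 → L := fun i => algebraMap (MvPolynomial (Fin 2) F) L (MvPolynomial.X i)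
  have hv : AlgebraicIndependent F v := by
    refine (MvPolynomial.algebraicIndependent_X (Fin 2) F).map'
      (f := IsScalarTower.toAlgHom F (MvPolynomial (Fin 2) F) L) ?_
    exact (algebraMap M L).injective.comp (IsFractionRing.injective _ M)
  obtain ⟨x, hx⟩ : ∃ x, x = v 0 := ⟨_, rfl⟩
  obtain ⟨A, hA⟩ : ∃ A, A = v 1 := ⟨_, rfl⟩
  have hAF : Transcendental F A := hA ▸ hv.transcendental 1
  let K := IntermediateField.adjoin F {x}
  let x₁ : K := IntermediateField.AdjoinSimple.gen F x
  have hx₁ : algebraMap K L x₁ = x := rfl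
  have hxt : Transcendental F x₁ := by
    refine (transcendental_algebraMap_iff (algebraMap K L).injective).1 ?_
    rw [hx₁, hx]
    exact hv.transcendental 0
  have hAK : Transcendental K A := by
    refine IntermediateField.transcendental_adjoin_iff.2 ?_
    have := hv.transcendental_adjoin (s := {0}) (i := 1) (by simp)
    rwa [Set.image_singleton, ← hx, ← hA] at this
  have hg0 : g ≠ 0 := by
    rintro rfl
    rw [isCoprime_zero_right] at hfg
    rw [natDegree_eq_zero_of_isUnit hfg] at hdeg
    omega
  obtain ⟨h, hfh, hcop, hwr⟩ := exists_eq_sq_mul_add_tangent hfg hdeg hW hxt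
  have hgx : aeval x g ≠ 0 := by
    rw [hx]; exact aeval_ne_zero_of_transcendental (hv.transcendental 0) hg0
  have haev : ∀ p : F[X], algebraMap K L (aeval x₁ p) = aeval x p := fun p =>
    (aeval_algebraMap_apply L x₁ p).symm
  let φ₀ : L := aeval x f / aeval x g
  let φ₁ : L := aeval x (derivative f * g - f * derivative g) / aeval x g ^ 2
  have hmm : ∀ p : F[X], (p.map (algebraMap F K)).map (algebraMap K L) =
      p.map (algebraMap F L) := fun p => by
    rw [Polynomial.map_map, ← IsScalarTower.algebraMap_eq]
  have hfhL : f.map (algebraMap F L) = (X - C x) ^ 2 * h.map (algebraMap K L) +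
      g.map (algebraMap F L) * (C φ₀ + C φ₁ * (X - C x)) := by
    have := congrArg (Polynomial.map (algebraMap K L)) hfh
    simpa only [hmm, Polynomial.map_add, Polynomial.map_mul, Polynomial.map_pow,
      Polynomial.map_sub, map_X, map_C, map_div₀, map_pow, haev, hx₁] using this
  -- The parameters are the coefficients of `-φ₀ - φ₁ * (X - x) + A * (X - x) ^ 2`.
  refine ⟨L, inferInstance, inferInstance, inferInstance, -φ₀ + φ₁ * x + A * x ^ 2,
    -φ₁ - 2 * A * x, A, ⟨x, h.map (algebraMap K L) + C A * g.map (algebraMap F L), ?_, ?_, ?_, hgx⟩,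
    ?_⟩
  · simp only [familyPoly, Fin.sum_univ_three, hfhL]
    simp only [Fin.isValue, Matrix.cons_val_zero, Matrix.cons_val_one, Matrix.cons_val,
      Fin.val_zero, Fin.val_one, Fin.val_two, C_add, C_mul, C_neg, C_sub, C_pow, pow_zero, pow_one,
      map_ofNat]
    ring
  · have := separable_map_add_C_mul hcop hwr hAK
    rwa [hmm] at this
  · intro h0
    rw [eval_add, eval_mul, eval_C, eval_map_algebraMap, eval_map_algebraMap] at h0
    apply hAK
    have hAe : A = algebraMap K L (- aeval x₁ h / aeval x₁ g) := by
      rw [map_div₀, map_neg, haev, ← aeval_algebraMap_apply, hx₁, eq_div_iff hgx]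
      linear_combination h0
    rw [hAe]
    exact isAlgebraic_algebraMap _
  · set a : Fin 2 → L := ![-φ₁ - 2 * A * x, A] with ha
    refine algebraicIndependent_of_isAlgebraic_adjoin hv ?_
    set K' := IntermediateField.adjoin F (Set.range a)
    let a₁ : K' := ⟨-φ₁ - 2 * A * x, IntermediateField.subset_adjoin F _ ⟨0, rfl⟩⟩
    let a₂ : K' := ⟨A, IntermediateField.subset_adjoin F _ ⟨1, rfl⟩⟩
    have ha₁ : algebraMap K' L a₁ = -φ₁ - 2 * A * x := rfl
    have ha₂ : algebraMap K' L a₂ = A := rfl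
    have hlc : algebraMap F L (g ^ 2).leadingCoeff ≠ 0 := by simpa using hg0
    intro i
    fin_cases i
    · change IsAlgebraic K' (v 0)
      rw [← hx]
      obtain ⟨W, hWd⟩ : ∃ W, W = derivative f * g - f * derivative g := ⟨_, rfl⟩
      obtain ⟨G, hG⟩ : ∃ G, G = g ^ 2 := ⟨_, rfl⟩
      rw [← hG] at hlc hW
      rw [← hWd] at hW
      have hWx : aeval x W = φ₁ * aeval x G := by
        rw [hWd, hG, map_pow]
        exact (div_mul_cancel₀ _ (pow_ne_zero 2 hgx)).symm
      refine ⟨W.map (algebraMap F K') + (C a₁ + C (2 * a₂) * X) * G.map (algebraMap F K'),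
        fun h0 => ?_, ?_⟩
      · have h1 : W.map (algebraMap F L) + (C (-φ₁ - 2 * A * x) * G.map (algebraMap F L) +
            C (2 * A) * (G.map (algebraMap F L) * X)) = 0 := by
          have h1 := congrArg (Polynomial.map (algebraMap K' L)) h0
          simp only [Polynomial.map_add, Polynomial.map_mul, map_C, Polynomial.map_map,
            ← IsScalarTower.algebraMap_eq, map_X, Polynomial.map_zero, ha₁] at h1
          rw [map_mul (algebraMap K' L), ha₂, map_ofNat] at h1
          linear_combination h1
        -- If this equation for `x` were trivial, comparing coefficients would express one of `a₁`,
        -- `a₂` in `F`; for `a₁` this means that `f / g` has constant derivative.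
        by_cases h2 : (2 : F) = 0
        · have h2' : (2 : L) = 0 := by
            rw [← map_ofNat (algebraMap F L) 2, h2, map_zero]
          have ha₁' : -φ₁ - 2 * A * x =
              algebraMap F L (-(W.coeff G.natDegree / G.leadingCoeff)) := by
            have := congrArg (fun p => coeff p G.natDegree) h1
            simp only [coeff_add, coeff_C_mul, coeff_map, coeff_natDegree, coeff_zero, h2',
              zero_mul, add_zero] at this
            rw [map_neg, map_div₀, ← neg_div (algebraMap F L G.leadingCoeff), eq_div_iff hlc, h2']
            linear_combination this
          rw [ha₁'] at h1
          refine hW h2 (W.coeff G.natDegree / G.leadingCoeff)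
            (map_injective (algebraMap F L) (algebraMap F L).injective ?_)
          rw [Polynomial.map_mul, map_C]
          rw [map_neg, C_neg, h2', zero_mul, C_0] at h1
          linear_combination h1
        · have h2' : (2 : L) ≠ 0 := by
            rw [← map_ofNat (algebraMap F L) 2]
            exact (_root_.map_ne_zero _).2 h2
          have hA' : A = algebraMap F L
              (-(W.coeff (G.natDegree + 1) / (2 * G.leadingCoeff))) := by
            have h3 := congrArg (fun p => coeff p (G.natDegree + 1)) h1
            have h4 : G.coeff (G.natDegree + 1) = 0 :=
              coeff_eq_zero_of_natDegree_lt (by omega)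
            simp only [coeff_add, coeff_C_mul, coeff_map, h4, coeff_mul_X, coeff_natDegree,
              coeff_zero, map_zero, mul_zero, zero_add] at h3
            rw [map_neg, map_div₀, ← neg_div, map_mul, map_ofNat, eq_div_iff (mul_ne_zero h2' hlc)]
            linear_combination h3
          apply hAF
          rw [hA']
          exact isAlgebraic_algebraMap _
      · simp only [map_add, map_mul, aeval_C, aeval_X, aeval_map_algebraMap, ha₁, ha₂, map_ofNat,
          hWx]
        ring
    · change IsAlgebraic K' (v 1)
      rw [← hA]
      exact isAlgebraic_algebraMap a₂

/-! ### A generic double root with more than three parameters -/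

/-- With at least three parameters there is a generic member of the family with a unique double
root: the parameters of index at least three are taken into the base field. -/
theorem exists_hasUniqueDoubleRoot_of_two_le.{u} {F : Type u} [Field F] {n : ℕ} {f g : F[X]}
    (hfg : IsCoprime f g) (hdeg : g.natDegree + (n + 2) < f.natDegree)
    (hW : (2 : F) = 0 → n = 0 → ∀ c, derivative f * g - f * derivative g ≠ C c * g ^ 2) :
    ∃ (L : Type u) (_ : Field L) (_ : IsAlgClosed L) (_ : Algebra F L) (b : Fin (n + 3) → L),
      HasUniqueDoubleRoot f g b ∧ AlgebraicIndependent F (b ∘ Fin.succ) := by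
  let F₁ := FractionRing (MvPolynomial (Fin n) F)
  let w : Fin n → F₁ := fun i => algebraMap (MvPolynomial (Fin n) F) F₁ (MvPolynomial.X i)
  have hw : AlgebraicIndependent F w :=
    (MvPolynomial.algebraicIndependent_X (Fin n) F).map'
      (f := IsScalarTower.toAlgHom F (MvPolynomial (Fin n) F) F₁) (IsFractionRing.injective _ F₁)
  have hg0 : g ≠ 0 := by
    rintro rfl
    rw [isCoprime_zero_right] at hfg
    rw [natDegree_eq_zero_of_isUnit hfg] at hdeg
    omega
  let S : F₁[X] := ∑ i, C (w i) * X ^ ((i : ℕ) + 3)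
  let g₁ := g.map (algebraMap F F₁)
  let f₁ := f.map (algebraMap F F₁) + g₁ * S
  have hg₁0 : g₁ ≠ 0 := by rwa [Ne, Polynomial.map_eq_zero]
  have hdeg₁ : f₁.natDegree = f.natDegree := by
    rw [natDegree_add_eq_left_of_natDegree_lt, natDegree_map]
    rw [natDegree_map]
    rcases Nat.eq_zero_or_pos n with rfl | hn
    · simp [S]; omega
    refine (natDegree_mul_le_of_le natDegree_map_le (natDegree_sum_le_of_forall_le (n := n + 2)
      _ _ fun i _ => (natDegree_C_mul_X_pow_le _ _).trans (by omega))).trans_lt hdeg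
  have hcop₁ : IsCoprime f₁ g₁ :=
    IsCoprime.add_mul_left_left (hfg.map (mapRingHom (algebraMap F F₁))) S
  have hW₁ : (2 : F₁) = 0 → ∀ c, derivative f₁ * g₁ - f₁ * derivative g₁ ≠ C c * g₁ ^ 2 := by
    intro h2 c hc
    have h2F : (2 : F) = 0 := by
      rwa [← map_eq_zero (algebraMap F F₁), map_ofNat]
    have h1 : (derivative f * g - f * derivative g).map (algebraMap F F₁) =
        g₁ ^ 2 * (C c - derivative S) := by
      simp only [Polynomial.map_sub, Polynomial.map_mul, ← derivative_map]
      simp only [f₁, derivative_add, derivative_mul] at hc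
      linear_combination hc
    obtain ⟨q, hq⟩ : g ^ 2 ∣ derivative f * g - f * derivative g := by
      rw [← map_dvd_map' (algebraMap F F₁), h1, Polynomial.map_pow]
      exact dvd_mul_right _ _
    have h3 : q.map (algebraMap F F₁) = C c - derivative S := by
      rw [hq, Polynomial.map_mul, Polynomial.map_pow] at h1
      exact mul_left_cancel₀ (pow_ne_zero 2 hg₁0) h1
    -- The derivative of `S` has the coefficient `3 * w 0` at `X ^ 2`, which is not in `F`.
    rcases Nat.eq_zero_or_pos n with rfl | hn
    · refine hW h2F rfl (q.coeff 0) ?_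
      have hdq : q.natDegree = 0 := by
        rw [← natDegree_map (algebraMap F F₁), h3]
        simp [S]
      rw [hq, mul_comm, ← eq_C_of_natDegree_eq_zero hdq]
    · have h4 := congrArg (fun p => coeff p 2) h3
      have h5 : (derivative S).coeff 2 = w ⟨0, hn⟩ * 3 := by
        rw [coeff_derivative, finsetSum_coeff, Finset.sum_eq_single ⟨0, hn⟩]
        · simp
          norm_num
        · intro i _ hi
          rw [coeff_C_mul_X_pow, if_neg]
          intro h6
          exact hi (Fin.ext (by simp; omega))
        · simp
      simp only [coeff_map, coeff_sub, coeff_C_succ, h5] at h4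
      refine hw.transcendental ⟨0, hn⟩ ?_
      have h6 : w ⟨0, hn⟩ = algebraMap F F₁ (- q.coeff 2) := by
        rw [map_neg]
        linear_combination h4 - w ⟨0, hn⟩ * h2
      rw [h6]
      exact isAlgebraic_algebraMap _
  obtain ⟨L, _, _, _, a₀, a₁, a₂, ⟨x, h, hP, hsep, hx, hgx⟩, ha⟩ :=
    exists_hasUniqueDoubleRoot_three hcop₁ (by rw [hdeg₁, natDegree_map]; omega) hW₁
  let : Algebra F L := ((algebraMap F₁ L).comp (algebraMap F F₁)).toAlgebra
  have : IsScalarTower F F₁ L := IsScalarTower.of_algebraMap_eq' rfl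
  let b : Fin (n + 3) → L :=
    Fin.cons a₀ (Fin.cons a₁ (Fin.cons a₂ fun i => algebraMap F₁ L (w i)))
  refine ⟨L, inferInstance, inferInstance, inferInstance, b, ⟨x, h, ?_, hsep, hx, ?_⟩, ?_⟩
  · rw [← hP]
    simp only [familyPoly, f₁, g₁, S, Polynomial.map_add, Polynomial.map_mul, Polynomial.map_sum,
      Polynomial.map_map, ← IsScalarTower.algebraMap_eq, map_C, Polynomial.map_pow, map_X, b,
      Fin.sum_univ_succ, Fin.cons_zero, Fin.cons_succ, Fin.val_zero, Fin.val_succ,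
      Fin.sum_univ_zero, Matrix.cons_val_zero, Matrix.cons_val_succ]
    ring
  · rwa [aeval_map_algebraMap] at hgx
  · let e : Fin (n + 2) → Fin 2 ⊕ Fin n := Fin.cons (Sum.inl 0) (Fin.cons (Sum.inl 1) Sum.inr)
    have he : Function.Injective e := by
      refine Fin.cons_injective_iff.2 ⟨?_, Fin.cons_injective_iff.2 ⟨by simp, Sum.inr_injective⟩⟩
      rintro ⟨i, hi⟩
      revert hi
      refine Fin.cases ?_ (fun i => ?_) i <;> simp
    convert (hw.sumElim_comp ha).comp e he using 1
    ext i
    refine Fin.cases ?_ (fun i => Fin.cases ?_ (fun i => ?_) i) i <;> rfl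

/-! ### A generic double root with two parameters -/

/-- The derivation `d / dX` extends to formally étale algebras over the polynomial ring. -/
theorem exists_derivation_X_eq_one (F M : Type*) [Field F] [Field M] [Algebra F M] [Algebra F[X] M]
    [IsScalarTower F F[X] M] [Algebra.FormallyEtale F[X] M] :
    ∃ D : Derivation F M M, D (algebraMap F[X] M X) = 1 := by
  let e := KaehlerDifferential.tensorKaehlerEquivOfFormallyEtale F F[X] M
  let d : Derivation F F[X] M := (Algebra.linearMap F[X] M).compDer derivative'
  let ℓ : TensorProduct F[X] M (Ω[F[X]⁄F]) →ₗ[M] M :=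
    LinearMap.liftBaseChange M d.liftKaehlerDifferential
  refine ⟨(ℓ ∘ₗ e.symm.toLinearMap).compDer (KaehlerDifferential.D F M), ?_⟩
  change ℓ (e.symm (KaehlerDifferential.D F M (algebraMap F[X] M X))) = 1
  rw [KaehlerDifferential.tensorKaehlerEquivOfFormallyEtale_symm_D_algebraMap]
  simp [ℓ, d]

/-- A simple root of a polynomial is a separable element, even if the polynomial is not
separable. -/
theorem isSeparable_of_aeval_derivative_ne_zero {K L : Type*} [Field K] [Field L] [Algebra K L]
    {q : K[X]} {y : L} (hy : aeval y q = 0) (hy' : aeval y (derivative q) ≠ 0) :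
    IsSeparable K y := by
  have hq : q ≠ 0 := by rintro rfl; simp at hy'
  have hint : IsIntegral K y := isAlgebraic_iff_isIntegral.1 ⟨q, hq, hy⟩
  obtain ⟨r, rfl⟩ := minpoly.dvd K y hy
  refine (separable_iff_derivative_ne_zero (minpoly.irreducible hint)).2 fun h => hy' ?_
  simp [h]

/-- The tangent to the graph of `f` at a generic point touches the graph at no other point, when
`f''` is nonzero: a second point of contact `y` would be separably algebraic over the field of the
first point `x`, and differentiating the equation of the tangent with respect to `x` would give
`f'' x * (y - x) = 0`. -/
theorem eq_of_common_tangent {F K L : Type*} [Field F] [Field K] [Field L] [Algebra F K]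
    [Algebra F[X] K] [IsScalarTower F F[X] K] [IsFractionRing F[X] K] [Algebra F L] [Algebra K L]
    [IsScalarTower F K L] {f : F[X]} (hf : derivative (derivative f) ≠ 0) {x y : L}
    (hx : x = algebraMap K L (algebraMap F[X] K X))
    (h1 : aeval y (derivative f) = aeval x (derivative f))
    (h0 : aeval y f = aeval x f + aeval x (derivative f) * (y - x)) : y = x := by
  have hxt₁ : Transcendental F (algebraMap F[X] K X) :=
    (transcendental_algebraMap_iff (IsFractionRing.injective F[X] K)).2 (transcendental_X F)
  have hxt : Transcendental F x := by
    rw [hx]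
    exact (transcendental_algebraMap_iff (algebraMap K L).injective).2 hxt₁
  have hdeg : (derivative f).natDegree ≠ 0 := by
    intro h
    apply hf
    rw [eq_C_of_natDegree_eq_zero h, derivative_C]
  have hx't : Transcendental F (aeval x (derivative f)) :=
    hxt.aeval _ hdeg (mem_nonZeroDivisors_of_ne_zero
      (leadingCoeff_ne_zero.2 (by rintro h; simp [h] at hdeg)))
  have hyt : Transcendental F y := by
    intro hy
    apply hx't
    rw [← h1]
    exact mem_algebraicClosure_iff.1 ((algebraicClosure F L).aeval_mem_of_mem
      (mem_algebraicClosure_iff.2 hy) _)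
  have hy2 : aeval y (derivative (derivative f)) ≠ 0 := aeval_ne_zero_of_transcendental hyt hf
  have hsep : IsSeparable K y := by
    refine isSeparable_of_aeval_derivative_ne_zero
      (q := (derivative f).map (algebraMap F K) - C (aeval (algebraMap F[X] K X) (derivative f)))
      ?_ ?_
    · rw [map_sub, aeval_map_algebraMap, aeval_C, ← aeval_algebraMap_apply, ← hx, h1, sub_self]
    · rwa [derivative_sub, derivative_C, sub_zero, derivative_map, aeval_map_algebraMap]
  let M := separableClosure K L
  let : Algebra F[X] M := ((algebraMap K M).comp (algebraMap F[X] K)).toAlgebra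
  have : IsScalarTower F[X] K M := IsScalarTower.of_algebraMap_eq' rfl
  have : IsScalarTower F F[X] M := IsScalarTower.of_algebraMap_eq' (by
    rw [IsScalarTower.algebraMap_eq F[X] K M, RingHom.comp_assoc,
      ← IsScalarTower.algebraMap_eq F F[X] K, ← IsScalarTower.algebraMap_eq F K M])
  have : IsScalarTower F M L := IsScalarTower.of_algebraMap_eq' (by
    rw [IsScalarTower.algebraMap_eq F K M, ← RingHom.comp_assoc,
      ← IsScalarTower.algebraMap_eq K M L, ← IsScalarTower.algebraMap_eq F K L])
  have : Algebra.FormallyEtale F[X] K := .of_isLocalization (nonZeroDivisors F[X])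
  have : Algebra.FormallyEtale K M := .of_isSeparable K M
  have : Algebra.FormallyEtale F[X] M := .comp F[X] K M
  obtain ⟨D, hD⟩ := exists_derivation_X_eq_one F M
  let y₁ : M := ⟨y, mem_separableClosure_iff.2 hsep⟩
  obtain ⟨x₁, hx₁⟩ : ∃ x₁, x₁ = algebraMap F[X] M X := ⟨_, rfl⟩
  rw [← hx₁] at hD
  have hxx : algebraMap M L x₁ = x := by rw [hx, hx₁]; rfl
  have hyy : algebraMap M L y₁ = y := rfl
  have hinj := (algebraMap M L).injective
  have h1' : aeval y₁ (derivative f) = aeval x₁ (derivative f) := by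
    apply hinj
    rw [← aeval_algebraMap_apply, ← aeval_algebraMap_apply, hxx, hyy, h1]
  have h0' : aeval y₁ f = aeval x₁ f + aeval x₁ (derivative f) * (y₁ - x₁) := by
    apply hinj
    simp only [map_add, map_mul, map_sub, ← aeval_algebraMap_apply, hxx, hyy, h0]
  have hd := congrArg D h0'
  simp only [map_add, Derivation.leibniz, map_sub, Derivation.map_aeval, hD, smul_eq_mul, h1',
    mul_one] at hd
  have hprod : (y₁ - x₁) * aeval x₁ (derivative (derivative f)) = 0 := by
    linear_combination -hd
  have hne : aeval x₁ (derivative (derivative f)) ≠ 0 := by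
    intro h
    apply aeval_ne_zero_of_transcendental hxt hf
    rw [← hxx, aeval_algebraMap_apply, h, map_zero]
  have hyx := sub_eq_zero.1 ((mul_eq_zero.1 hprod).resolve_right hne)
  rw [← hxx, ← hyy, hyx]

/-- With two parameters and constant `g` there is a generic member of the family with a unique
double root: it describes the intersection of the graph of `f` with the tangent at a generic
point. -/
theorem exists_hasUniqueDoubleRoot_two.{u} {F : Type u} [Field F] {f : F[X]} {c : F} (hc : c ≠ 0)
    (hf : derivative (derivative f) ≠ 0) :
    ∃ (L : Type u) (_ : Field L) (_ : IsAlgClosed L) (_ : Algebra F L) (b : Fin 2 → L),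
      HasUniqueDoubleRoot f (C c) b ∧ AlgebraicIndependent F (b ∘ Fin.succ) := by
  let K := FractionRing F[X]
  let L := AlgebraicClosure K
  obtain ⟨x, hx⟩ : ∃ x : L, x = algebraMap K L (algebraMap F[X] K X) := ⟨_, rfl⟩
  have hxt : Transcendental F x := by
    rw [hx]
    exact (transcendental_algebraMap_iff (algebraMap K L).injective).2
      ((transcendental_algebraMap_iff (IsFractionRing.injective F[X] K)).2 (transcendental_X F))
  have hcL : algebraMap F L c ≠ 0 := by simpa using hc
  -- With these parameters the polynomial is `f` minus its tangent at `x`.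
  let b : Fin 2 → L := ![-(aeval x f - aeval x (derivative f) * x) / algebraMap F L c,
    -aeval x (derivative f) / algebraMap F L c]
  have hP : familyPoly f (C c) b = f.map (algebraMap F L) -
      (C (aeval x f) + C (aeval x (derivative f)) * (X - C x)) := by
    have e0 : C (algebraMap F L c) * C (b 0) = -C (aeval x f - aeval x (derivative f) * x) := by
      rw [← C_mul, ← C_neg, mul_comm]
      exact congrArg C (div_mul_cancel₀ _ hcL)
    have e1 : C (algebraMap F L c) * C (b 1) = -C (aeval x (derivative f)) := by
      rw [← C_mul, ← C_neg, mul_comm]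
      exact congrArg C (div_mul_cancel₀ _ hcL)
    rw [familyPoly, Fin.sum_univ_two, map_C]
    simp only [Fin.val_zero, Fin.val_one, pow_zero, pow_one, mul_one]
    rw [mul_add, ← mul_assoc, e0, e1, C_sub, C_mul]
    ring
  have hev : ∀ y, (familyPoly f (C c) b).eval y =
      aeval y f - (aeval x f + aeval x (derivative f) * (y - x)) := fun y => by
    rw [hP]; simp
  have hev' : ∀ y, (derivative (familyPoly f (C c) b)).eval y =
      aeval y (derivative f) - aeval x (derivative f) := fun y => by
    rw [hP]; simp [derivative_map]
  obtain ⟨h, hh⟩ := sq_X_sub_C_dvd (Q := familyPoly f (C c) b) (x := x)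
    (by rw [hev]; ring) (by rw [hev']; ring)
  have hhx : h.eval x ≠ 0 := by
    intro h0
    apply aeval_ne_zero_of_transcendental hxt hf
    have h1 : (derivative (derivative (familyPoly f (C c) b))).eval x =
        aeval x (derivative (derivative f)) := by
      rw [hP]; simp [derivative_map]
    rw [← h1, hh]
    simp [sq, h0]
  refine ⟨L, inferInstance, inferInstance, inferInstance, b, ⟨x, h, hh, ?_, hhx, ?_⟩, ?_⟩
  · rw [Polynomial.Separable, isCoprime_iff_aeval_ne_zero_of_isAlgClosed L L]
    intro y
    by_contra! hy
    obtain ⟨hy1, hy2⟩ := hy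
    simp only [coe_aeval_eq_eval] at hy1 hy2
    have hy0 : (familyPoly f (C c) b).eval y = 0 := by rw [hh]; simp [hy1]
    have hy0' : (derivative (familyPoly f (C c) b)).eval y = 0 := by rw [hh]; simp [hy1, hy2]
    rw [hev] at hy0
    rw [hev'] at hy0'
    have hyx := eq_of_common_tangent (K := K) hf hx (sub_eq_zero.1 hy0') (sub_eq_zero.1 hy0)
    rw [hyx] at hy1
    exact hhx hy1
  · simpa using hc
  · rw [algebraicIndependent_unique_type_iff]
    have hdeg : (C (-c⁻¹) * derivative f).natDegree ≠ 0 := by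
      rw [natDegree_C_mul (neg_ne_zero.2 (inv_ne_zero hc))]
      intro h
      apply hf
      rw [eq_C_of_natDegree_eq_zero h, derivative_C]
    have h1 := hxt.aeval (C (-c⁻¹) * derivative f) hdeg (mem_nonZeroDivisors_of_ne_zero
      (leadingCoeff_ne_zero.2 fun h => hdeg (by rw [h, natDegree_zero])))
    have h2 : (b ∘ Fin.succ) default = aeval x (C (-c⁻¹) * derivative f) := by
      change -aeval x (derivative f) / algebraMap F L c = _
      rw [map_mul, aeval_C, map_neg, map_inv₀, div_eq_inv_mul, mul_neg, neg_mul]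
    rwa [← h2] at h1

/-! ### The Galois group of the generic polynomial -/

theorem mainTheorem5 {F : Type*} [Field F] (p : ℕ) [CharP F p] (m k : ℕ) (f g : F[X])
    (hm : 1 ≤ m) (hfg : IsCoprime f g) (hf : f.natDegree = k) (hg : g.natDegree + m < k)
    (h1 : 0 < g.natDegree → 2 ≤ m)
    (h2 : p ∣ k * (k - 1) → 2 ≤ m)
    (h3 : p = 2 → m = 2 → ∀ c : F,
      ratDeriv (algebraMap F[X] (RatFunc F) f / algebraMap F[X] (RatFunc F) g) ≠ RatFunc.C c) :
    GaloisGroupIsSymmetric (genericPoly m f g) k := by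
  have hg0 : g ≠ 0 := by
    rintro rfl
    rw [isCoprime_zero_right] at hfg
    rw [natDegree_eq_zero_of_isUnit hfg] at hf
    omega
  rcases hm.eq_or_lt with rfl | hm2
  · obtain ⟨c, rfl⟩ : ∃ c, g = C c :=
      ⟨_, eq_C_of_natDegree_eq_zero (by by_contra h; have := h1 (by omega); omega)⟩
    have hc : c ≠ 0 := by simpa using hg0
    have hff : derivative (derivative f) ≠ 0 := by
      intro h
      -- The coefficient of `X ^ (k - 2)` in `f''` is `k * (k - 1)` times the leading one of `f`.
      have h4 := congrArg (fun q => coeff q (k - 2)) h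
      simp only [coeff_derivative, coeff_zero] at h4
      rw [show k - 2 + 1 + 1 = k by omega, ← hf, coeff_natDegree, hf, mul_assoc] at h4
      have h5 := (mul_eq_zero.1 h4).resolve_left
        (leadingCoeff_ne_zero.2 (by rintro rfl; simp at hf; omega))
      have h6 : ((k * (k - 1) : ℕ) : F) = 0 := by
        rw [← h5]
        obtain ⟨j, rfl⟩ : ∃ j, k = j + 2 := ⟨k - 2, by omega⟩
        rw [show j + 2 - 1 = j + 1 by omega, show j + 2 - 2 = j by omega]
        push_cast
        ring
      have := h2 ((CharP.cast_eq_zero_iff F p _).1 h6)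
      omega
    obtain ⟨L, _, _, _, b, hb, hb'⟩ := exists_hasUniqueDoubleRoot_two hc hff
    obtain ⟨a, ha, hcard⟩ := hb.exists_ncard_roots (n := 0) (by omega) hb'
    exact galoisGroupIsSymmetric_of_ncard_rootSet hfg hf hg ha (hcard.trans hf)
  · obtain ⟨n, rfl⟩ : ∃ n, m = n + 2 := ⟨m - 2, by omega⟩
    have hW : (2 : F) = 0 → n = 0 → ∀ c, derivative f * g - f * derivative g ≠ C c * g ^ 2 := by
      intro hF hn c hc
      have hp : p = 2 := CharP.eq F inferInstance
        (CharTwo.of_one_ne_zero_of_two_eq_zero one_ne_zero hF)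
      refine h3 hp (by omega) c ?_
      rw [ratDeriv_div f g hg0, hc, map_mul, map_pow, RatFunc.algebraMap_C,
        mul_div_cancel_right₀ _ (pow_ne_zero 2 (RatFunc.algebraMap_ne_zero hg0))]
    obtain ⟨L, _, _, _, b, hb, hb'⟩ := exists_hasUniqueDoubleRoot_of_two_le hfg (by omega) hW
    obtain ⟨a, ha, hcard⟩ := hb.exists_ncard_roots (n := n + 1) (by omega) hb'
    exact galoisGroupIsSymmetric_of_ncard_rootSet hfg hf (by omega) ha (hcard.trans hf)
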